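/- Let $(\Omega,\mathcal F,\mathsf P)$ be a probability space, $0\le t<T$, let $(\mathcal F_s)_{s\in[0,T]}$ be a filtration, and let $W=(W^{(1)},\dots,W^{(m)})$ be a standard $m$-dimensional Wiener process on $[0,T]$ with independent components, adapted to $(\mathcal F_s)$ and with increments $W_u-W_s$ independent of $\mathcal F_s$ for $0\le s\le u\le T$. Let $P_j(x)=\frac{1}{2^j j!}\frac{d^j}{dx^j}(x^2-1)^j$ be the Legendre polynomials and $$\phi_j(x)=\sqrt{\frac{2j+1}{T-t}}\;P_j\!\left(\Bigl(x-\frac{T+t}{2}\Bigr)\frac{2}{T-t}\right),\qquad j=0,1,2,\dots,$$ the corresponding orthonormal system in $L_2([t,T])$. Fix $i\in\{1,\dots,m\}$. Then the Itô stochastic integrals $$I_{(l)}=\int_t^T (t-s)^l\,dW^{(i)}_s,\qquad \zeta_j=\int_t^T\phi_j(s)\,dW^{(i)}_s\qquad(l,j=0,1,2,3)$$ exist, and with probability $1$ $$I_{(0)}=\sqrt{T-t}\,\zeta_0,$$ $$I_{(1)}=-\frac{(T-t)^{3/2}}{2}\Bigl(\zeta_0+\frac{1}{\sqrt3}\zeta_1\Bigr),$$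 $$I_{(2)}=\frac{(T-t)^{5/2}}{3}\Bigl(\zeta_0+\frac{\sqrt3}{2}\zeta_1+\frac{1}{2\sqrt5}\zeta_2\Bigr),$$ $$I_{(3)}=-\frac{(T-t)^{7/2}}{4}\Bigl(\zeta_0+\frac{3\sqrt3}{5}\zeta_1+\frac{1}{\sqrt5}\zeta_2+\frac{1}{5\sqrt7}\zeta_3\Bigr).$$ -/

import Mathlib

open MeasureTheory ProbabilityTheory Filter Topology

noncomputable section

/-- `W = (W 1, …, W m)` is a standard `m`-dimensional Wiener process on the time interval `[0, T]`
with respect to the filtration `𝓕` and the probability measure `P`, with independent components.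
Time is indexed by `ℝ`, but only the times in `[0, T]` are constrained. -/
structure IsWiener {Ω : Type*} {mΩ : MeasurableSpace Ω} (P : Measure Ω)
    (𝓕 : Filtration ℝ mΩ) (T : ℝ) {m : ℕ} (W : Fin m → ℝ → Ω → ℝ) : Prop where
  adapted : ∀ i, ∀ s ∈ Set.Icc 0 T, Measurable[𝓕 s] (W i s)
  start_zero : ∀ i, ∀ᵐ ω ∂P, W i 0 ω = 0
  continuous_paths : ∀ i, ∀ᵐ ω ∂P, ContinuousOn (fun s => W i s ω) (Set.Icc 0 T)
  increment_law : ∀ i, ∀ s u : ℝ, 0 ≤ s → s ≤ u → u ≤ T →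
    HasLaw (fun ω => W i u ω - W i s ω) (gaussianReal 0 (u - s).toNNReal) P
  increment_indep : ∀ s u : ℝ, 0 ≤ s → s ≤ u → u ≤ T →
    Indep (MeasurableSpace.comap (fun ω (i : Fin m) => W i u ω - W i s ω) inferInstance) (𝓕 s) P
  components_indep : iIndepFun (fun (i : Fin m) ω (s : Set.Icc (0 : ℝ) T) => W i s ω) P

/-- A simple (step) process on `[t, T]`: on each interval `[τ k, τ (k + 1))`, `k < n`, of the
partition `t = τ 0 ≤ τ 1 ≤ … ≤ τ n = T` it equals the square integrable, `𝓕 (τ k)`-measurable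
random variable `ξ k`. -/
structure SimpleIntegrand {Ω : Type*} {mΩ : MeasurableSpace Ω} (P : Measure Ω)
    (𝓕 : Filtration ℝ mΩ) (t T : ℝ) where
  n : ℕ
  τ : ℕ → ℝ
  mono : Monotone τ
  left : τ 0 = t
  right : τ n = T
  ξ : ℕ → Ω → ℝ
  measurable_ξ : ∀ k < n, Measurable[𝓕 (τ k)] (ξ k)
  memLp_ξ : ∀ k < n, MemLp (ξ k) 2 P

/-- The value at time `s` of a simple process. -/
def SimpleIntegrand.value {Ω : Type*} {mΩ : MeasurableSpace Ω} {P : Measure Ω}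
    {𝓕 : Filtration ℝ mΩ} {t T : ℝ} (S : SimpleIntegrand P 𝓕 t T) (s : ℝ) (ω : Ω) : ℝ :=
  ∑ k ∈ Finset.range S.n, (Set.Ico (S.τ k) (S.τ (k + 1))).indicator (fun _ => S.ξ k ω) s

/-- The Itô integral of a simple process with respect to the scalar process `B`. -/
def SimpleIntegrand.integral {Ω : Type*} {mΩ : MeasurableSpace Ω} {P : Measure Ω}
    {𝓕 : Filtration ℝ mΩ} {t T : ℝ} (S : SimpleIntegrand P 𝓕 t T) (B : ℝ → Ω → ℝ) (ω : Ω) : ℝ :=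
  ∑ k ∈ Finset.range S.n, S.ξ k ω * (B (S.τ (k + 1)) ω - B (S.τ k) ω)

/-- The class of Itô integrands on `[t, T]`: jointly measurable, adapted, and square integrable
with respect to `ds ⊗ dP`. -/
structure IsItoIntegrand {Ω : Type*} {mΩ : MeasurableSpace Ω} (P : Measure Ω)
    (𝓕 : Filtration ℝ mΩ) (t T : ℝ) (f : ℝ → Ω → ℝ) : Prop where
  measurable : Measurable (fun p : Set.Icc t T × Ω => f p.1 p.2)
  adapted : ∀ s ∈ Set.Icc t T, Measurable[𝓕 s] (f s)
  memLp : MemLp (fun p : ℝ × Ω => f p.1 p.2) 2 ((volume.restrict (Set.Icc t T)).prod P)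

/-- The random variable `X` is (a version of) the Itô integral `∫_t^T f_s dB_s`: it is the
mean-square limit of the integrals of simple processes that converge to `f` in
`L²([t, T] × Ω)`. -/
structure IsItoIntegral {Ω : Type*} {mΩ : MeasurableSpace Ω} (P : Measure Ω)
    (𝓕 : Filtration ℝ mΩ) (B : ℝ → Ω → ℝ) (t T : ℝ) (f : ℝ → Ω → ℝ) (X : Ω → ℝ) : Prop where
  integrand : IsItoIntegrand P 𝓕 t T f
  memLp : MemLp X 2 P
  limit : ∃ S : ℕ → SimpleIntegrand P 𝓕 t T,
    Tendsto (fun n => eLpNorm (fun p : ℝ × Ω => (S n).value p.1 p.2 - f p.1 p.2) 2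
      ((volume.restrict (Set.Icc t T)).prod P)) atTop (𝓝 0) ∧
    Tendsto (fun n => eLpNorm (fun ω => (S n).integral B ω - X ω) 2 P) atTop (𝓝 0)

/-- The Legendre polynomial `P_j = (1 / (2^j j!)) d^j/dx^j (x^2 - 1)^j`. -/
def legendreP (j : ℕ) : Polynomial ℝ :=
  Polynomial.C (1 / (2 ^ j * (j.factorial : ℝ))) *
    Polynomial.derivative^[j] ((Polynomial.X ^ 2 - 1) ^ j)

/-- The orthonormal Legendre polynomials in `L²([t, T])`. -/
def legendrePhi (t T : ℝ) (j : ℕ) (x : ℝ) : ℝ :=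
  √((2 * (j : ℝ) + 1) / (T - t)) * (legendreP j).eval ((x - (T + t) / 2) * (2 / (T - t)))

end

/-! The Itô integral preserves inner products from L²(ds ⊗ dP) to L²(P), and this alone forces
linearity: the distance between Y and ∑ c_k X_k equals the distance between their integrands, hence
is 0 when the integrands agree (`IsItoIntegral.ae_eq_sum`). So the expansions reduce, for any choice
of versions, to the algebraic identities writing (t - s)^l in φ_0, …, φ_l.

The isometry starts from two elementary integrands (`IsWiener.integral_mul_increment_mul`), is
summed over partition cells, and passes to mean-square limits by continuity of the inner product
(`IsItoIntegral.inner_eq`). For existence, left-endpoint step functions approximate a continuous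
integrand uniformly on [t, T), and the isometry makes their integrals Cauchy in L²(P). -/

/-! ### Moments of Wiener increments with adapted coefficients -/

namespace IsWiener

variable {Ω : Type*} {mΩ : MeasurableSpace Ω} {P : Measure Ω} {𝓕 : Filtration ℝ mΩ} {T : ℝ}
  {m : ℕ} {W : Fin m → ℝ → Ω → ℝ}

lemma measurable_increment (hW : IsWiener P 𝓕 T W) (i : Fin m) {s u : ℝ} (hs : 0 ≤ s)
    (hsu : s ≤ u) (hu : u ≤ T) : Measurable[𝓕 u] (fun ω => W i u ω - W i s ω) :=
  Measurable.sub (hW.adapted i u ⟨hs.trans hsu, hu⟩)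
    ((hW.adapted i s ⟨hs, hsu.trans hu⟩).mono (𝓕.mono hsu) le_rfl)

lemma indepFun_increment (hW : IsWiener P 𝓕 T W) (i : Fin m) {s u : ℝ} (hs : 0 ≤ s)
    (hsu : s ≤ u) (hu : u ≤ T) {X : Ω → ℝ} (hX : Measurable[𝓕 s] X) :
    IndepFun X (fun ω => W i u ω - W i s ω) P := by
  rw [IndepFun_iff_Indep]
  refine (indep_of_indep_of_le_left (indep_of_indep_of_le_right
    (hW.increment_indep s u hs hsu hu) hX.comap_le) ?_).symm
  rintro _ ⟨A, hA, rfl⟩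
  exact ⟨(fun x : Fin m → ℝ => x i) ⁻¹' A, measurable_pi_apply i hA, rfl⟩

lemma memLp_increment (hW : IsWiener P 𝓕 T W) (i : Fin m) {s u : ℝ} (hs : 0 ≤ s)
    (hsu : s ≤ u) (hu : u ≤ T) : MemLp (fun ω => W i u ω - W i s ω) 2 P := by
  have h := hW.increment_law i s u hs hsu hu
  have h2 : MemLp id 2 (gaussianReal 0 (u - s).toNNReal) := memLp_id_gaussianReal' 2 (by simp)
  rw [← h.map_eq] at h2
  exact h2.comp_of_map h.aemeasurable

lemma integral_increment (hW : IsWiener P 𝓕 T W) (i : Fin m) {s u : ℝ} (hs : 0 ≤ s)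
    (hsu : s ≤ u) (hu : u ≤ T) : ∫ ω, (W i u ω - W i s ω) ∂P = 0 := by
  rw [(hW.increment_law i s u hs hsu hu).integral_eq]
  exact integral_id_gaussianReal

lemma integral_increment_sq (hW : IsWiener P 𝓕 T W) (i : Fin m) {s u : ℝ} (hs : 0 ≤ s)
    (hsu : s ≤ u) (hu : u ≤ T) : ∫ ω, (W i u ω - W i s ω) ^ 2 ∂P = u - s := by
  have h := hW.increment_law i s u hs hsu hu
  have hv := h.variance_eq
  rw [variance_id_gaussianReal,
    variance_of_integral_eq_zero h.aemeasurable (hW.integral_increment i hs hsu hu)] at hv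
  rw [hv, Real.coe_toNNReal _ (by linarith)]

/-- Independence of the two squares makes their product integrable, so second moments of `X`
suffice. -/
lemma memLp_mul_increment (hW : IsWiener P 𝓕 T W) (i : Fin m) {s u : ℝ} (hs : 0 ≤ s)
    (hsu : s ≤ u) (hu : u ≤ T) {X : Ω → ℝ} (hX : Measurable[𝓕 s] X) (hX2 : MemLp X 2 P) :
    MemLp (fun ω => X ω * (W i u ω - W i s ω)) 2 P := by
  have hB := hW.memLp_increment i hs hsu hu
  refine (memLp_two_iff_integrable_sq (hX2.1.mul hB.1)).2 ?_
  have hind := (hW.indepFun_increment i hs hsu hu hX).comp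
    (φ := fun x => x ^ 2) (ψ := fun x => x ^ 2) (by fun_prop) (by fun_prop)
  refine (hind.integrable_mul hX2.integrable_sq hB.integrable_sq).congr (ae_of_all _ fun ω => ?_)
  simp [mul_pow]

lemma integral_mul_increment (hW : IsWiener P 𝓕 T W) (i : Fin m) {s u : ℝ} (hs : 0 ≤ s)
    (hsu : s ≤ u) (hu : u ≤ T) {X : Ω → ℝ} (hX : Measurable[𝓕 s] X) :
    ∫ ω, X ω * (W i u ω - W i s ω) ∂P = 0 := by
  rw [(hW.indepFun_increment i hs hsu hu hX).integral_fun_mul_eq_mul_integral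
    (hX.mono (𝓕.le s) le_rfl).aestronglyMeasurable (hW.memLp_increment i hs hsu hu).1,
    hW.integral_increment i hs hsu hu, mul_zero]

lemma integral_mul_increment_sq (hW : IsWiener P 𝓕 T W) (i : Fin m) {s u : ℝ} (hs : 0 ≤ s)
    (hsu : s ≤ u) (hu : u ≤ T) {X : Ω → ℝ} (hX : Measurable[𝓕 s] X) :
    ∫ ω, X ω * (W i u ω - W i s ω) ^ 2 ∂P = (∫ ω, X ω ∂P) * (u - s) := by
  have hind := (hW.indepFun_increment i hs hsu hu hX).comp
    (φ := id) (ψ := fun x => x ^ 2) measurable_id (by fun_prop)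
  have h := hind.integral_fun_mul_eq_mul_integral
    (hX.mono (𝓕.le s) le_rfl).aestronglyMeasurable
    ((hW.memLp_increment i hs hsu hu).1.pow 2)
  simp only [Function.comp_def, id] at h
  rw [h, hW.integral_increment_sq i hs hsu hu]

/-- Integrability of a product of two `𝓕 s`-measurable square integrable random
variables with the square of a later increment. -/
lemma integrable_mul_mul_increment_sq (hW : IsWiener P 𝓕 T W) (i : Fin m) {s u : ℝ} (hs : 0 ≤ s)
    (hsu : s ≤ u) (hu : u ≤ T) {X Y : Ω → ℝ} (hX : Measurable[𝓕 s] X) (hX2 : MemLp X 2 P)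
    (hY : Measurable[𝓕 s] Y) (hY2 : MemLp Y 2 P) :
    Integrable (fun ω => (X ω * Y ω) * (W i u ω - W i s ω) ^ 2) P := by
  refine ((hW.memLp_mul_increment i hs hsu hu hX hX2).integrable_mul
    (hW.memLp_mul_increment i hs hsu hu hY hY2)).congr (ae_of_all _ fun ω => ?_)
  simp only [Pi.mul_apply]
  ring

/-- Increments over intervals starting at the same point. -/
lemma integral_mul_increment_mul_of_eq (hW : IsWiener P 𝓕 T W) (i : Fin m) {a b d : ℝ}
    (ha : 0 ≤ a) (hab : a ≤ b) (hbd : b ≤ d) (hd : d ≤ T) {X Y : Ω → ℝ}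
    (hX : Measurable[𝓕 a] X) (hX2 : MemLp X 2 P) (hY : Measurable[𝓕 a] Y) (hY2 : MemLp Y 2 P) :
    ∫ ω, (X ω * (W i b ω - W i a ω)) * (Y ω * (W i d ω - W i a ω)) ∂P
      = (∫ ω, X ω * Y ω ∂P) * (b - a) := by
  have hb : 0 ≤ b := ha.trans hab
  have hbT : b ≤ T := hbd.trans hd
  have hXb : Measurable[𝓕 b] (fun ω => X ω * (W i b ω - W i a ω)) :=
    Measurable.mul (hX.mono (𝓕.mono hab) le_rfl) (hW.measurable_increment i ha hab hbT)
  have hYb : Measurable[𝓕 b] Y := hY.mono (𝓕.mono hab) le_rfl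
  have hXY : Measurable[𝓕 a] (fun ω => X ω * Y ω) := Measurable.mul hX hY
  have hXbY : Measurable[𝓕 b] (fun ω => X ω * (W i b ω - W i a ω) * Y ω) := Measurable.mul hXb hYb
  have h1 : ∀ ω, (X ω * (W i b ω - W i a ω)) * (Y ω * (W i d ω - W i a ω))
      = (X ω * Y ω) * (W i b ω - W i a ω) ^ 2
        + (X ω * (W i b ω - W i a ω) * Y ω) * (W i d ω - W i b ω) := fun ω => by ring
  simp_rw [h1]
  rw [integral_add (hW.integrable_mul_mul_increment_sq i ha hab hbT hX hX2 hY hY2),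
    hW.integral_mul_increment_sq i ha hab hbT hXY,
    hW.integral_mul_increment i hb hbd hd hXbY, add_zero]
  refine ((hW.memLp_mul_increment i ha hab hbT hX hX2).integrable_mul
    (hW.memLp_mul_increment i hb hbd hd hYb hY2)).congr (ae_of_all _ fun ω => ?_)
  simp only [Pi.mul_apply]
  ring

/-- Cut the first increment at c. Its part over [a, c] is known at time c, hence orthogonal to the
later increment; what remains is a pair of increments with common start c. The factor `max (min b d
- c) 0` is the length of the overlap. -/
lemma integral_mul_increment_mul_of_le (hW : IsWiener P 𝓕 T W) (i : Fin m) {a b c d : ℝ}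
    (ha : 0 ≤ a) (hab : a ≤ b) (hb : b ≤ T) (hac : a ≤ c) (hcd : c ≤ d) (hd : d ≤ T)
    {X Y : Ω → ℝ}
    (hX : Measurable[𝓕 a] X) (hX2 : MemLp X 2 P) (hY : Measurable[𝓕 c] Y) (hY2 : MemLp Y 2 P) :
    ∫ ω, (X ω * (W i b ω - W i a ω)) * (Y ω * (W i d ω - W i c ω)) ∂P
      = (∫ ω, X ω * Y ω ∂P) * max (min b d - c) 0 := by
  have hc : 0 ≤ c := ha.trans hac
  have hXc : Measurable[𝓕 c] X := hX.mono (𝓕.mono hac) le_rfl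
  rcases le_total b c with hbc | hcb
  · rw [max_eq_right (by linarith [min_le_left b d]), mul_zero]
    have hXb : Measurable[𝓕 c] (fun ω => X ω * (W i b ω - W i a ω)) :=
      Measurable.mul hXc ((hW.measurable_increment i ha hab hb).mono (𝓕.mono hbc) le_rfl)
    simp_rw [← mul_assoc]
    exact hW.integral_mul_increment i hc hcd hd (Measurable.mul hXb hY)
  · have hcT : c ≤ T := hcd.trans hd
    have hXb : Measurable[𝓕 c] (fun ω => X ω * (W i c ω - W i a ω)) :=
      Measurable.mul hXc (hW.measurable_increment i ha hac hcT)
    have hXbY : Measurable[𝓕 c] (fun ω => X ω * (W i c ω - W i a ω) * Y ω) :=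
      Measurable.mul hXb hY
    have h1 : ∀ ω, (X ω * (W i b ω - W i a ω)) * (Y ω * (W i d ω - W i c ω))
        = (X ω * (W i c ω - W i a ω) * Y ω) * (W i d ω - W i c ω)
          + (X ω * (W i b ω - W i c ω)) * (Y ω * (W i d ω - W i c ω)) := fun ω => by ring
    simp_rw [h1]
    have hYd := hW.memLp_mul_increment i hc hcd hd hY hY2
    rw [integral_add, hW.integral_mul_increment i hc hcd hd hXbY, zero_add]
    · rcases le_total b d with hbd | hdb
      · rw [hW.integral_mul_increment_mul_of_eq i hc hcb hbd hd hXc hX2 hY hY2, min_eq_left hbd,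
          max_eq_left (by linarith)]
      -- The common-start formula wants the shorter increment first, so the factors are swapped.
      · simp_rw [fun ω => mul_comm (X ω * (W i b ω - W i c ω)) (Y ω * (W i d ω - W i c ω))]
        rw [hW.integral_mul_increment_mul_of_eq i hc hcd hdb hb hY hY2 hXc hX2, min_eq_right hdb,
          max_eq_left (by linarith)]
        simp_rw [mul_comm]
    · refine ((hW.memLp_mul_increment i ha hac hcT hX hX2).integrable_mul hYd).congr
        (ae_of_all _ fun ω => ?_)
      simp only [Pi.mul_apply]
      ring
    · exact (hW.memLp_mul_increment i hc hcb hb hXc hX2).integrable_mul hYd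

/-- The Itô isometry for two elementary integrands. -/
lemma integral_mul_increment_mul (hW : IsWiener P 𝓕 T W) (i : Fin m) {a b c d : ℝ}
    (ha : 0 ≤ a) (hab : a ≤ b) (hb : b ≤ T) (hc : 0 ≤ c) (hcd : c ≤ d) (hd : d ≤ T)
    {X Y : Ω → ℝ}
    (hX : Measurable[𝓕 a] X) (hX2 : MemLp X 2 P) (hY : Measurable[𝓕 c] Y) (hY2 : MemLp Y 2 P) :
    ∫ ω, (X ω * (W i b ω - W i a ω)) * (Y ω * (W i d ω - W i c ω)) ∂P
      = (∫ ω, X ω * Y ω ∂P) * volume.real (Set.Ico a b ∩ Set.Ico c d) := by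
  rw [Set.Ico_inter_Ico, measureReal_def, Real.volume_Ico, ENNReal.toReal_ofReal']
  rcases le_total a c with hac | hca
  · rw [hW.integral_mul_increment_mul_of_le i ha hab hb hac hcd hd hX hX2 hY hY2, sup_eq_right.2 hac]
  · simp_rw [fun ω => mul_comm (X ω * (W i b ω - W i a ω)) (Y ω * (W i d ω - W i c ω)),
      fun ω => mul_comm (X ω) (Y ω)]
    rw [hW.integral_mul_increment_mul_of_le i hc hcd hd hca hab hb hY hY2 hX hX2,
      sup_eq_left.2 hca, min_comm]

end IsWiener

/-! ### Isometry for simple processes -/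

lemma MeasureTheory.integral_sum_sum_mul {α ι κ : Type*} {mα : MeasurableSpace α} {μ : Measure α}
    {s : Finset ι} {s' : Finset κ} {f : ι → α → ℝ} {g : κ → α → ℝ}
    (hf : ∀ k ∈ s, MemLp (f k) 2 μ) (hg : ∀ l ∈ s', MemLp (g l) 2 μ) :
    ∫ a, ∑ k ∈ s, ∑ l ∈ s', f k a * g l a ∂μ = ∑ k ∈ s, ∑ l ∈ s', ∫ a, f k a * g l a ∂μ := by
  have h : ∀ k ∈ s, ∀ l ∈ s', Integrable (fun a => f k a * g l a) μ :=
    fun k hk l hl => (hf k hk).integrable_mul (hg l hl)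
  rw [integral_finsetSum _ fun k hk => integrable_finsetSum _ fun l hl => h k hk l hl]
  exact Finset.sum_congr rfl fun k hk => integral_finsetSum _ fun l hl => h k hk l hl

namespace SimpleIntegrand

variable {Ω : Type*} {mΩ : MeasurableSpace Ω} {P : Measure Ω} {𝓕 : Filtration ℝ mΩ} {t T : ℝ}
  {m : ℕ} {W : Fin m → ℝ → Ω → ℝ}

lemma le_τ (S : SimpleIntegrand P 𝓕 t T) (k : ℕ) : t ≤ S.τ k :=
  S.left.symm.le.trans (S.mono k.zero_le)

lemma τ_le (S : SimpleIntegrand P 𝓕 t T) {k : ℕ} (hk : k ≤ S.n) : S.τ k ≤ T :=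
  (S.mono hk).trans S.right.le

lemma value_eq_sum (S : SimpleIntegrand P 𝓕 t T) (s : ℝ) (ω : Ω) :
    S.value s ω = ∑ k ∈ Finset.range S.n,
      (Set.Ico (S.τ k) (S.τ (k + 1))).indicator (fun _ => (1 : ℝ)) s * S.ξ k ω := by
  refine Finset.sum_congr rfl fun k _ => ?_
  by_cases hs : s ∈ Set.Ico (S.τ k) (S.τ (k + 1)) <;> simp [hs]

lemma memLp_indicator_mul [IsProbabilityMeasure P] (a b : ℝ) {X : Ω → ℝ} (hX : MemLp X 2 P) :
    MemLp (fun p : ℝ × Ω => (Set.Ico a b).indicator (fun _ => (1 : ℝ)) p.1 * X p.2) 2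
      ((volume.restrict (Set.Icc t T)).prod P) := by
  have h1 : MemLp ((Set.Ico a b).indicator (fun _ => (1 : ℝ))) 2
      (volume.restrict (Set.Icc t T)) := (memLp_const 1).indicator measurableSet_Ico
  refine (memLp_two_iff_integrable_sq (h1.1.comp_fst.mul hX.1.comp_snd)).2 ?_
  simp_rw [Pi.mul_apply, mul_pow]
  exact h1.integrable_sq.mul_prod hX.integrable_sq

lemma integral_indicator_mul_mul [IsProbabilityMeasure P] {a b : ℝ} (c d : ℝ) (X Y : Ω → ℝ)
    (hta : t ≤ a) (hbT : b ≤ T) :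
    ∫ p : ℝ × Ω, ((Set.Ico a b).indicator (fun _ => (1 : ℝ)) p.1 * X p.2) *
        ((Set.Ico c d).indicator (fun _ => (1 : ℝ)) p.1 * Y p.2)
        ∂((volume.restrict (Set.Icc t T)).prod P)
      = (∫ ω, X ω * Y ω ∂P) * volume.real (Set.Ico a b ∩ Set.Ico c d) := by
  have h : ∀ p : ℝ × Ω, ((Set.Ico a b).indicator (fun _ => (1 : ℝ)) p.1 * X p.2) *
        ((Set.Ico c d).indicator (fun _ => (1 : ℝ)) p.1 * Y p.2)
      = (Set.Ico a b ∩ Set.Ico c d).indicator (fun _ => (1 : ℝ)) p.1 * (X p.2 * Y p.2) := by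
    intro p
    by_cases h1 : p.1 ∈ Set.Ico a b <;> by_cases h2 : p.1 ∈ Set.Ico c d <;> simp [h1, h2]
  -- It is enough that one of the intervals lies in [t, T]: the restriction of Lebesgue measure then
  -- does not affect the intersection.
  have hsub : Set.Ico a b ∩ Set.Ico c d ⊆ Set.Icc t T :=
    Set.inter_subset_left.trans fun x hx => ⟨hta.trans hx.1, hx.2.le.trans hbT⟩
  have hm : MeasurableSet (Set.Ico a b ∩ Set.Ico c d) := measurableSet_Ico.inter measurableSet_Ico
  simp_rw [h]
  rw [integral_prod_mul (μ := volume.restrict (Set.Icc t T)) (ν := P)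
      ((Set.Ico a b ∩ Set.Ico c d).indicator (fun _ => (1 : ℝ))) (fun ω => X ω * Y ω),
    integral_indicator hm, Measure.restrict_restrict hm, Set.inter_eq_left.2 hsub, mul_comm]
  simp

lemma memLp_value [IsProbabilityMeasure P] (S : SimpleIntegrand P 𝓕 t T) :
    MemLp (fun p : ℝ × Ω => S.value p.1 p.2) 2 ((volume.restrict (Set.Icc t T)).prod P) := by
  simp_rw [value_eq_sum]
  exact memLp_finsetSum _ fun k hk => memLp_indicator_mul _ _ (S.memLp_ξ k (Finset.mem_range.1 hk))

lemma memLp_term (hW : IsWiener P 𝓕 T W) (ht : 0 ≤ t) (i : Fin m)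
    (S : SimpleIntegrand P 𝓕 t T) {k : ℕ} (hk : k < S.n) :
    MemLp (fun ω => S.ξ k ω * (W i (S.τ (k + 1)) ω - W i (S.τ k) ω)) 2 P :=
  hW.memLp_mul_increment i (ht.trans (S.le_τ k)) (S.mono k.le_succ) (S.τ_le hk)
    (S.measurable_ξ k hk) (S.memLp_ξ k hk)

lemma memLp_integral (hW : IsWiener P 𝓕 T W) (ht : 0 ≤ t) (i : Fin m)
    (S : SimpleIntegrand P 𝓕 t T) : MemLp (S.integral (W i)) 2 P :=
  memLp_finsetSum _ fun _ hk => S.memLp_term hW ht i (Finset.mem_range.1 hk)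

/-- The Itô isometry for simple processes, in bilinear form. -/
lemma integral_integral_mul_integral [IsProbabilityMeasure P] (hW : IsWiener P 𝓕 T W)
    (ht : 0 ≤ t) (i : Fin m) (S S' : SimpleIntegrand P 𝓕 t T) :
    ∫ ω, S.integral (W i) ω * S'.integral (W i) ω ∂P
      = ∫ p : ℝ × Ω, S.value p.1 p.2 * S'.value p.1 p.2
          ∂((volume.restrict (Set.Icc t T)).prod P) := by
  simp_rw [SimpleIntegrand.integral, value_eq_sum, Finset.sum_mul_sum]
  have hk (S : SimpleIntegrand P 𝓕 t T) {k : ℕ} (hk : k ∈ Finset.range S.n) : k < S.n :=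
    Finset.mem_range.1 hk
  rw [integral_sum_sum_mul (fun k h => S.memLp_term hW ht i (hk S h))
      (fun l h => S'.memLp_term hW ht i (hk S' h)),
    integral_sum_sum_mul (fun k h => memLp_indicator_mul _ _ (S.memLp_ξ k (hk S h)))
      (fun l h => memLp_indicator_mul _ _ (S'.memLp_ξ l (hk S' h)))]
  refine Finset.sum_congr rfl fun k h => Finset.sum_congr rfl fun l h' => ?_
  rw [integral_indicator_mul_mul _ _ _ _ (S.le_τ k) (S.τ_le (hk S h))]
  exact hW.integral_mul_increment_mul i (ht.trans (S.le_τ k)) (S.mono k.le_succ)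
    (S.τ_le (hk S h)) (ht.trans (S'.le_τ l)) (S'.mono l.le_succ) (S'.τ_le (hk S' h'))
    (S.measurable_ξ k (hk S h)) (S.memLp_ξ k (hk S h))
    (S'.measurable_ξ l (hk S' h')) (S'.memLp_ξ l (hk S' h'))

end SimpleIntegrand

/-! ### Isometry and linearity for mean-square limits -/

lemma MeasureTheory.MemLp.inner_toLp {α : Type*} {mα : MeasurableSpace α} {μ : Measure α}
    {f g : α → ℝ} (hf : MemLp f 2 μ) (hg : MemLp g 2 μ) :
    inner ℝ (hf.toLp f) (hg.toLp g) = ∫ a, f a * g a ∂μ := by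
  rw [L2.inner_def]
  refine integral_congr_ae ?_
  filter_upwards [hf.coeFn_toLp, hg.coeFn_toLp] with a h1 h2
  rw [h1, h2, RCLike.inner_apply, conj_trivial, mul_comm]

/-- Equal Gram matrices give equal distances. This transfers norms between L²(P) and L²(ds ⊗ dP)
without constructing the integral as a linear map. -/
lemma norm_sub_eq_of_inner_eq {E F : Type*} [NormedAddCommGroup E] [InnerProductSpace ℝ E]
    [NormedAddCommGroup F] [InnerProductSpace ℝ F] {x y : E} {u v : F}
    (hxx : inner ℝ x x = inner ℝ u u) (hxy : inner ℝ x y = inner ℝ u v)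
    (hyy : inner ℝ y y = inner ℝ v v) : ‖x - y‖ = ‖u - v‖ := by
  rw [← sq_eq_sq₀ (norm_nonneg _) (norm_nonneg _), norm_sub_sq_real, norm_sub_sq_real,
    ← real_inner_self_eq_norm_sq, ← real_inner_self_eq_norm_sq, ← real_inner_self_eq_norm_sq,
    ← real_inner_self_eq_norm_sq, hxx, hxy, hyy]

section ItoIntegral

variable {Ω : Type*} {mΩ : MeasurableSpace Ω} {P : Measure Ω} [IsProbabilityMeasure P]
  {𝓕 : Filtration ℝ mΩ} {t T : ℝ} {m : ℕ} {W : Fin m → ℝ → Ω → ℝ}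

/-- The Itô isometry in bilinear form. -/
lemma IsItoIntegral.inner_eq (hW : IsWiener P 𝓕 T W) (ht : 0 ≤ t) (i : Fin m)
    {f g : ℝ → Ω → ℝ} {X Y : Ω → ℝ} (hX : IsItoIntegral P 𝓕 (W i) t T f X)
    (hY : IsItoIntegral P 𝓕 (W i) t T g Y) :
    inner ℝ (hX.memLp.toLp X) (hY.memLp.toLp Y)
      = inner ℝ (hX.integrand.memLp.toLp _) (hY.integrand.memLp.toLp _) := by
  obtain ⟨S, hSv, hSi⟩ := hX.limit
  obtain ⟨S', hSv', hSi'⟩ := hY.limit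
  have h1 := (Lp.tendsto_Lp_iff_tendsto_eLpNorm'' _
    (fun n => (S n).memLp_integral hW ht i) _ hX.memLp).2 hSi
  have h2 := (Lp.tendsto_Lp_iff_tendsto_eLpNorm'' _
    (fun n => (S' n).memLp_integral hW ht i) _ hY.memLp).2 hSi'
  have h3 := (Lp.tendsto_Lp_iff_tendsto_eLpNorm'' _
    (fun n => (S n).memLp_value) _ hX.integrand.memLp).2 hSv
  have h4 := (Lp.tendsto_Lp_iff_tendsto_eLpNorm'' _
    (fun n => (S' n).memLp_value) _ hY.integrand.memLp).2 hSv'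
  -- Both inner products are limits of the same real sequence, by the isometry for simple processes.
  refine tendsto_nhds_unique (h1.inner h2) ((h3.inner h4).congr fun n => ?_)
  rw [MemLp.inner_toLp, MemLp.inner_toLp,
    SimpleIntegrand.integral_integral_mul_integral hW ht i]

/-- The Itô integral of a linear combination is the linear combination of the Itô integrals. -/
lemma IsItoIntegral.ae_eq_sum (hW : IsWiener P 𝓕 T W) (ht : 0 ≤ t) (i : Fin m)
    {ι : Type*} [Fintype ι] {f : ι → ℝ → Ω → ℝ} {g : ℝ → Ω → ℝ} {X : ι → Ω → ℝ} {Y : Ω → ℝ}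
    (hX : ∀ k, IsItoIntegral P 𝓕 (W i) t T (f k) (X k))
    (hY : IsItoIntegral P 𝓕 (W i) t T g Y) (c : ι → ℝ)
    (hg : ∀ s ω, g s ω = ∑ k, c k * f k s ω) :
    ∀ᵐ ω ∂P, Y ω = ∑ k, c k * X k ω := by
  have hsX : MemLp (fun ω => ∑ k, c k * X k ω) 2 P :=
    memLp_finsetSum _ fun k _ => (hX k).memLp.const_mul (c k)
  have hx : hsX.toLp _ = ∑ k, c k • (hX k).memLp.toLp (X k) := by
    rw [Lp.ext_iff]
    refine hsX.coeFn_toLp.trans ((Lp.coeFn_finsetSum _ _).trans ?_).symm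
    have : ∀ᵐ ω ∂P, ∀ k, (c k • (hX k).memLp.toLp (X k) : Lp ℝ 2 P) ω = c k * X k ω := by
      refine ae_all_iff.2 fun k => ?_
      filter_upwards [Lp.coeFn_smul (c k) ((hX k).memLp.toLp (X k)), (hX k).memLp.coeFn_toLp]
        with ω h1 h2
      rw [h1, Pi.smul_apply, h2, smul_eq_mul]
    filter_upwards [this] with ω h
    simp [h]
  have hu : hY.integrand.memLp.toLp _ = ∑ k, c k • (hX k).integrand.memLp.toLp _ := by
    rw [Lp.ext_iff]
    refine hY.integrand.memLp.coeFn_toLp.trans ((Lp.coeFn_finsetSum _ _).trans ?_).symm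
    have : ∀ᵐ p ∂((volume.restrict (Set.Icc t T)).prod P), ∀ k,
        (c k • (hX k).integrand.memLp.toLp _ : Lp ℝ 2 _) p = c k * f k p.1 p.2 := by
      refine ae_all_iff.2 fun k => ?_
      filter_upwards [Lp.coeFn_smul (c k) ((hX k).integrand.memLp.toLp _),
        (hX k).integrand.memLp.coeFn_toLp] with ω h1 h2
      rw [h1, Pi.smul_apply, h2, smul_eq_mul]
    filter_upwards [this] with p h
    simp [h, hg]
  have hnorm : ‖hY.memLp.toLp Y - hsX.toLp _‖
      = ‖hY.integrand.memLp.toLp _ - ∑ k, c k • (hX k).integrand.memLp.toLp _‖ := by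
    rw [hx]
    refine norm_sub_eq_of_inner_eq (hY.inner_eq hW ht i hY) ?_ ?_
    · simp only [inner_sum, inner_smul_right, hY.inner_eq hW ht i (hX _)]
    · simp only [inner_sum, sum_inner, inner_smul_right, inner_smul_left,
        (hX _).inner_eq hW ht i (hX _)]
  rw [← hu, sub_self, norm_zero, norm_eq_zero, sub_eq_zero, MemLp.toLp_eq_toLp_iff] at hnorm
  exact hnorm

end ItoIntegral

/-! ### Existence for continuous deterministic integrands -/

section Existence

variable {Ω : Type*} {mΩ : MeasurableSpace Ω} {P : Measure Ω} [IsProbabilityMeasure P]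
  {𝓕 : Filtration ℝ mΩ} {t T : ℝ} {m : ℕ} {W : Fin m → ℝ → Ω → ℝ}

lemma sum_range_indicator_Ico {τ : ℕ → ℝ} (hτ : Monotone τ) (n : ℕ) (s : ℝ) :
    ∑ k ∈ Finset.range n, (Set.Ico (τ k) (τ (k + 1))).indicator (fun _ => (1 : ℝ)) s
      = (Set.Ico (τ 0) (τ n)).indicator (fun _ => (1 : ℝ)) s := by
  induction n with
  | zero => simp
  | succ n ih =>
    have hd : Disjoint (Set.Ico (τ 0) (τ n)) (Set.Ico (τ n) (τ (n + 1))) :=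
      Set.Ico_disjoint_Ico_same
    rw [Finset.sum_range_succ, ih, ← Set.Ico_union_Ico_eq_Ico (hτ n.zero_le) (hτ n.le_succ),
      Set.indicator_union_of_disjoint hd]

/-- The step function that samples a deterministic function at the left end points of the uniform
partition of `[t, T]` into `n + 1` intervals. -/
noncomputable def SimpleIntegrand.uniform (P : Measure Ω) [IsProbabilityMeasure P]
    (𝓕 : Filtration ℝ mΩ) (htT : t ≤ T) (f : ℝ → ℝ) (n : ℕ) : SimpleIntegrand P 𝓕 t T where
  n := n + 1
  -- Capping the index keeps the sequence monotone and constantly T past the last cell; n + 1 cells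
  -- avoid division by zero at n = 0.
  τ k := t + (min k (n + 1) : ℕ) * ((T - t) / (n + 1))
  mono k l hkl := by
    have h0 : (0 : ℝ) ≤ (T - t) / (n + 1) := div_nonneg (by linarith) (by positivity)
    have h1 : ((min k (n + 1) : ℕ) : ℝ) ≤ (min l (n + 1) : ℕ) := by
      exact_mod_cast min_le_min_right _ hkl
    exact add_le_add le_rfl (mul_le_mul_of_nonneg_right h1 h0)
  left := by simp
  right := by
    rw [min_self]
    push_cast
    field_simp
    ring
  ξ k _ := f (t + (min k (n + 1) : ℕ) * ((T - t) / (n + 1)))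
  measurable_ξ _ _ := measurable_const
  memLp_ξ _ _ := memLp_const _

/-- On [t, T) the cell indicators sum to 1, so the error is ∑ 1_cell(s) (f(τ_k) - f(s)), and only
the cell containing s contributes. The point T is excluded because the half-open cells miss it. -/
lemma SimpleIntegrand.abs_uniform_value_sub_le (htT : t ≤ T) {f : ℝ → ℝ} {n : ℕ} {δ ε : ℝ}
    (hn : (T - t) / (n + 1) < δ)
    (hf : ∀ x ∈ Set.Icc t T, ∀ y ∈ Set.Icc t T, dist x y < δ → dist (f x) (f y) < ε)
    {s : ℝ} (hs : s ∈ Set.Ico t T) (ω : Ω) :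
    |(SimpleIntegrand.uniform P 𝓕 htT f n).value s ω - f s| ≤ ε := by
  set S := SimpleIntegrand.uniform P 𝓕 htT f n with hS
  have hone := sum_range_indicator_Ico S.mono S.n s
  rw [S.left, S.right, Set.indicator_of_mem hs] at hone
  have hstep : ∀ k, S.τ (k + 1) - S.τ k ≤ (T - t) / (n + 1) := by
    intro k
    have h0 : (0 : ℝ) ≤ (T - t) / (n + 1) := div_nonneg (by linarith) (by positivity)
    have h1 : ((min (k + 1) (n + 1) : ℕ) : ℝ) ≤ (min k (n + 1) : ℕ) + 1 := by
      exact_mod_cast (by omega : min (k + 1) (n + 1) ≤ min k (n + 1) + 1)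
    have h2 := mul_le_mul_of_nonneg_right h1 h0
    simp only [hS, SimpleIntegrand.uniform]
    linarith
  calc |S.value s ω - f s|
      = |∑ k ∈ Finset.range S.n, (Set.Ico (S.τ k) (S.τ (k + 1))).indicator (fun _ => (1 : ℝ)) s
          * (f (S.τ k) - f s)| := by
        rw [S.value_eq_sum]
        simp_rw [mul_sub]
        rw [Finset.sum_sub_distrib, ← Finset.sum_mul, hone, one_mul]
        rfl
    _ ≤ ∑ k ∈ Finset.range S.n, (Set.Ico (S.τ k) (S.τ (k + 1))).indicator (fun _ => (1 : ℝ)) s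
          * ε := by
        refine (Finset.abs_sum_le_sum_abs _ _).trans (Finset.sum_le_sum fun k hk => ?_)
        by_cases h : s ∈ Set.Ico (S.τ k) (S.τ (k + 1))
        · rw [Set.indicator_of_mem h, one_mul, one_mul]
          refine (hf _ ⟨S.le_τ k, S.τ_le (Finset.mem_range.1 hk).le⟩ s ⟨hs.1, hs.2.le⟩ ?_).le
          rw [Real.dist_eq, abs_sub_comm, abs_of_nonneg (by linarith [h.1])]
          linarith [h.2, hstep k]
        · simp [h]
    _ = ε := by rw [← Finset.sum_mul, hone, one_mul]

lemma SimpleIntegrand.tendsto_uniform_value (htT : t ≤ T) {f : ℝ → ℝ} (hf : Continuous f) :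
    Tendsto (fun n => eLpNorm (fun p : ℝ × Ω =>
        (SimpleIntegrand.uniform P 𝓕 htT f n).value p.1 p.2 - f p.1) 2
      ((volume.restrict (Set.Icc t T)).prod P)) atTop (𝓝 0) := by
  set μ := (volume.restrict (Set.Icc t T)).prod P with hμ
  set C := μ Set.univ ^ (ENNReal.toReal 2)⁻¹ with hC
  have hCtop : C ≠ ⊤ := ENNReal.rpow_ne_top_of_nonneg (by positivity) (measure_ne_top _ _)
  -- The uncovered endpoint T is Lebesgue-null.
  have hae : ∀ᵐ p ∂μ, p.1 ∈ Set.Ico t T := by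
    have h : ∀ᵐ s ∂(volume.restrict (Set.Icc t T)), s ∈ Set.Ico t T := by
      rw [← restrict_Ico_eq_restrict_Icc]
      exact ae_restrict_mem measurableSet_Ico
    exact Measure.quasiMeasurePreserving_fst.ae h
  have hbound : ∀ ε > 0, ∀ᶠ n in atTop, eLpNorm (fun p : ℝ × Ω =>
      (SimpleIntegrand.uniform P 𝓕 htT f n).value p.1 p.2 - f p.1) 2 μ
        ≤ C * ENNReal.ofReal ε := by
    intro ε hε
    obtain ⟨δ, hδ, h⟩ := Metric.uniformContinuousOn_iff.1
      (isCompact_Icc.uniformContinuousOn_of_continuous (s := Set.Icc t T) hf.continuousOn) ε hε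
    have hlim : Tendsto (fun n : ℕ => (T - t) / ((n : ℝ) + 1)) atTop (𝓝 0) :=
      tendsto_const_nhds.div_atTop (tendsto_natCast_atTop_atTop.atTop_add tendsto_const_nhds)
    filter_upwards [hlim.eventually (gt_mem_nhds hδ)] with n hn
    refine eLpNorm_le_of_ae_bound ?_
    filter_upwards [hae] with p hp
    exact SimpleIntegrand.abs_uniform_value_sub_le htT hn h hp p.2
  rw [ENNReal.tendsto_nhds_zero]
  intro η hη
  have hlim : Tendsto (fun ε : ℝ => C * ENNReal.ofReal ε) (𝓝[>] 0) (𝓝 0) := by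
    have h1 : Tendsto (fun ε : ℝ => ENNReal.ofReal ε) (𝓝[>] 0) (𝓝 0) := by
      simpa using (ENNReal.continuous_ofReal.tendsto 0).mono_left nhdsWithin_le_nhds
    simpa using ENNReal.Tendsto.const_mul h1 (Or.inr hCtop)
  obtain ⟨ε, hεη, hε⟩ := ((ENNReal.tendsto_nhds_zero.1 hlim η hη).and
    self_mem_nhdsWithin).exists
  filter_upwards [hbound ε hε] with n hn
  exact hn.trans hεη

lemma isItoIntegrand_of_continuous {f : ℝ → ℝ} (hf : Continuous f) :
    IsItoIntegrand P 𝓕 t T (fun s _ => f s) where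
  measurable := by fun_prop
  adapted _ _ := measurable_const
  memLp := by
    obtain ⟨C, hC⟩ := isCompact_Icc.exists_bound_of_continuousOn (s := Set.Icc t T) hf.continuousOn
    refine MemLp.of_bound (by fun_prop) C ?_
    exact Measure.quasiMeasurePreserving_fst.ae
      ((ae_restrict_mem measurableSet_Icc).mono fun s hs => hC s hs)

/-- The Itô integral of a continuous deterministic function exists. -/
lemma exists_isItoIntegral_of_continuous (hW : IsWiener P 𝓕 T W) (ht : 0 ≤ t) (htT : t ≤ T)
    (i : Fin m) {f : ℝ → ℝ} (hf : Continuous f) :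
    ∃ X, IsItoIntegral P 𝓕 (W i) t T (fun s _ => f s) X := by
  have hI : IsItoIntegrand P 𝓕 t T (fun s _ => f s) := isItoIntegrand_of_continuous hf
  let S := SimpleIntegrand.uniform P 𝓕 htT f
  have hv := SimpleIntegrand.tendsto_uniform_value (P := P) (𝓕 := 𝓕) htT hf
  have hdist : ∀ n k, dist (((S n).memLp_integral hW ht i).toLp) (((S k).memLp_integral hW ht i).toLp)
      = dist ((S n).memLp_value.toLp) ((S k).memLp_value.toLp) := by
    have hin : ∀ n k, inner ℝ (((S n).memLp_integral hW ht i).toLp)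
        (((S k).memLp_integral hW ht i).toLp)
        = inner ℝ ((S n).memLp_value.toLp) ((S k).memLp_value.toLp) := fun n k => by
      rw [MemLp.inner_toLp, MemLp.inner_toLp,
        SimpleIntegrand.integral_integral_mul_integral hW ht i]
    intro n k
    rw [dist_eq_norm, dist_eq_norm, norm_sub_eq_of_inner_eq (hin _ _) (hin _ _) (hin _ _)]
  have hc := ((Lp.tendsto_Lp_iff_tendsto_eLpNorm'' _
    (fun n => (S n).memLp_value) _ hI.memLp).2 hv).cauchySeq
  -- The step functions converge, hence are Cauchy; equal distances carry this to their integrals.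
  have hc' : CauchySeq fun n => ((S n).memLp_integral hW ht i).toLp := by
    rw [Metric.cauchySeq_iff] at hc ⊢
    simpa only [hdist] using hc
  obtain ⟨X, hX⟩ := cauchySeq_tendsto_of_complete hc'
  refine ⟨X, hI, Lp.memLp X, S, hv, ?_⟩
  rw [← Lp.toLp_coeFn X (Lp.memLp X)] at hX
  exact (Lp.tendsto_Lp_iff_tendsto_eLpNorm'' _
    (fun n => (S n).memLp_integral hW ht i) _ (Lp.memLp X)).1 hX

end Existence

/-! ### Monomials in the Legendre basis -/

section Legendre

lemma continuous_legendrePhi (t T : ℝ) (j : ℕ) : Continuous (legendrePhi t T j) := by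
  unfold legendrePhi
  fun_prop

lemma legendreP_zero_eval (x : ℝ) : (legendreP 0).eval x = 1 := by
  simp [legendreP]

lemma legendreP_one_eval (x : ℝ) : (legendreP 1).eval x = x := by
  simp [legendreP]
  ring

lemma legendreP_two_eval (x : ℝ) : (legendreP 2).eval x = (3 * x ^ 2 - 1) / 2 := by
  simp [legendreP, Polynomial.derivative_pow, Nat.factorial]
  ring

lemma legendreP_three_eval (x : ℝ) : (legendreP 3).eval x = (5 * x ^ 3 - 3 * x) / 2 := by
  simp [legendreP, Polynomial.derivative_pow, Nat.factorial]
  ring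

lemma legendrePhi_eq {t T : ℝ} (j : ℕ) (s : ℝ) :
    legendrePhi t T j s = √(2 * (j : ℝ) + 1) / √(T - t) *
      (legendreP j).eval ((s - (T + t) / 2) * (2 / (T - t))) := by
  rw [legendrePhi, Real.sqrt_div (by positivity)]

lemma Real.rpow_div_two_eq_sqrt_pow {x : ℝ} (hx : 0 ≤ x) (n : ℕ) :
    x ^ ((n : ℝ) / 2) = √x ^ n := by
  rw [Real.sqrt_eq_rpow, ← Real.rpow_natCast, ← Real.rpow_mul hx]
  congr 1
  ring

/-- In the rescaled variable y, which runs over [-1, 1], t - s is -(T - t)/2 · (1 + y), so its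
powers are polynomials in y. Writing T - t as `√(T - t) ^ 2` matches the root in the normalization
of φ_j. -/
lemma sub_eq_legendre_variable {t T : ℝ} (htT : t < T) (s : ℝ) :
    t - s = -(√(T - t) ^ 2 / 2) * (1 + (s - (T + t) / 2) * (2 / (T - t))) := by
  have h : T - t ≠ 0 := by linarith
  rw [Real.sq_sqrt (by linarith)]
  field_simp
  ring

lemma one_eq_legendre {t T : ℝ} (htT : t < T) (s : ℝ) :
    1 = √(T - t) * legendrePhi t T 0 s := by
  have hr : √(T - t) ≠ 0 := (Real.sqrt_pos.2 (by linarith)).ne'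
  rw [legendrePhi_eq, legendreP_zero_eval]
  simp [hr]

lemma sub_eq_legendre {t T : ℝ} (htT : t < T) (s : ℝ) :
    t - s = -(√(T - t) ^ 3 / 2) * (legendrePhi t T 0 s + 1 / √3 * legendrePhi t T 1 s) := by
  have hr : √(T - t) ≠ 0 := (Real.sqrt_pos.2 (by linarith)).ne'
  rw [sub_eq_legendre_variable htT s]
  simp only [legendrePhi_eq, legendreP_zero_eval, legendreP_one_eval]
  generalize (s - (T + t) / 2) * (2 / (T - t)) = y
  norm_num
  field_simp

lemma sub_sq_eq_legendre {t T : ℝ} (htT : t < T) (s : ℝ) :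
    (t - s) ^ 2 = √(T - t) ^ 5 / 3 * (legendrePhi t T 0 s + √3 / 2 * legendrePhi t T 1 s
      + 1 / (2 * √5) * legendrePhi t T 2 s) := by
  have hr : √(T - t) ≠ 0 := (Real.sqrt_pos.2 (by linarith)).ne'
  -- The coefficient of φ_1 and its normalization both carry √3 in the numerator; √5 cancels.
  have h3 : √(3 : ℝ) ^ 2 = 3 := Real.sq_sqrt (by norm_num)
  rw [sub_eq_legendre_variable htT s]
  simp only [legendrePhi_eq, legendreP_zero_eval, legendreP_one_eval, legendreP_two_eval]
  generalize (s - (T + t) / 2) * (2 / (T - t)) = y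
  norm_num
  field_simp
  rw [h3]
  ring

lemma sub_cube_eq_legendre {t T : ℝ} (htT : t < T) (s : ℝ) :
    (t - s) ^ 3 = -(√(T - t) ^ 7 / 4) * (legendrePhi t T 0 s + 3 * √3 / 5 * legendrePhi t T 1 s
      + 1 / √5 * legendrePhi t T 2 s + 1 / (5 * √7) * legendrePhi t T 3 s) := by
  have hr : √(T - t) ≠ 0 := (Real.sqrt_pos.2 (by linarith)).ne'
  have h3 : √(3 : ℝ) ^ 2 = 3 := Real.sq_sqrt (by norm_num)
  rw [sub_eq_legendre_variable htT s]
  simp only [legendrePhi_eq, legendreP_zero_eval, legendreP_one_eval, legendreP_two_eval,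
    legendreP_three_eval]
  generalize (s - (T + t) / 2) * (2 / (T - t)) = y
  norm_num
  field_simp
  rw [h3]
  ring

end Legendre

/-! ### Assembly of the expansions -/

theorem mainTheorem3 {Ω : Type*} {mΩ : MeasurableSpace Ω} (P : Measure Ω) [IsProbabilityMeasure P]
    (t T : ℝ) (ht : 0 ≤ t) (htT : t < T) (𝓕 : Filtration ℝ mΩ)
    {m : ℕ} (W : Fin m → ℝ → Ω → ℝ) (hW : IsWiener P 𝓕 T W) (i : Fin m) :
    -- the stochastic integrals exist
    (∀ l ≤ 3, ∃ X : Ω → ℝ, IsItoIntegral P 𝓕 (W i) t T (fun s _ => (t - s) ^ l) X) ∧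
    (∀ j ≤ 3, ∃ X : Ω → ℝ, IsItoIntegral P 𝓕 (W i) t T (fun s _ => legendrePhi t T j s) X) ∧
    -- and every choice of versions of them satisfies the expansions with probability 1
    ∀ I ζ : ℕ → Ω → ℝ,
      (∀ l ≤ 3, IsItoIntegral P 𝓕 (W i) t T (fun s _ => (t - s) ^ l) (I l)) →
      (∀ j ≤ 3, IsItoIntegral P 𝓕 (W i) t T (fun s _ => legendrePhi t T j s) (ζ j)) →
      (∀ᵐ ω ∂P, I 0 ω = √(T - t) * ζ 0 ω) ∧
      (∀ᵐ ω ∂P, I 1 ω = -((T - t) ^ (3 / 2 : ℝ) / 2) * (ζ 0 ω + 1 / √3 * ζ 1 ω)) ∧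
      (∀ᵐ ω ∂P, I 2 ω = (T - t) ^ (5 / 2 : ℝ) / 3 *
        (ζ 0 ω + √3 / 2 * ζ 1 ω + 1 / (2 * √5) * ζ 2 ω)) ∧
      (∀ᵐ ω ∂P, I 3 ω = -((T - t) ^ (7 / 2 : ℝ) / 4) *
        (ζ 0 ω + 3 * √3 / 5 * ζ 1 ω + 1 / √5 * ζ 2 ω + 1 / (5 * √7) * ζ 3 ω)) := by
  refine ⟨fun l _ => exists_isItoIntegral_of_continuous hW ht htT.le i (by fun_prop),
    fun j _ => exists_isItoIntegral_of_continuous hW ht htT.le i (continuous_legendrePhi t T j),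
    fun I ζ hI hζ => ?_⟩
  have hpow : ∀ n : ℕ, (T - t) ^ ((n : ℝ) / 2) = √(T - t) ^ n :=
    Real.rpow_div_two_eq_sqrt_pow (by linarith)
  have h3 := hpow 3
  have h5 := hpow 5
  have h7 := hpow 7
  push_cast at h3 h5 h7
  rw [h3, h5, h7]
  -- (t - s)^l has degree l, so only φ_0, …, φ_l occur.
  have key : ∀ l (hl : l ≤ 3) (c : Fin (l + 1) → ℝ),
      (∀ s, (t - s) ^ l = ∑ k, c k * legendrePhi t T k s) →
      ∀ᵐ ω ∂P, I l ω = ∑ k, c k * ζ k ω := fun l hl c hc =>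
    IsItoIntegral.ae_eq_sum hW ht i (fun k : Fin (l + 1) => hζ k (by omega)) (hI l hl) c
      fun s _ => hc s
  refine ⟨?_, ?_, ?_, ?_⟩
  · filter_upwards [key 0 (by norm_num) ![√(T - t)] fun s => by
      simpa using one_eq_legendre htT s] with ω h
    simpa using h
  · filter_upwards [key 1 (by norm_num)
      ![-(√(T - t) ^ 3 / 2), -(√(T - t) ^ 3 / 2) * (1 / √3)] fun s => by
        rw [pow_one, sub_eq_legendre htT s]
        simp [Fin.sum_univ_succ]
        ring] with ω h
    rw [h]
    simp [Fin.sum_univ_succ]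
    ring
  · filter_upwards [key 2 (by norm_num)
      ![√(T - t) ^ 5 / 3, √(T - t) ^ 5 / 3 * (√3 / 2), √(T - t) ^ 5 / 3 * (1 / (2 * √5))]
      fun s => by
        rw [sub_sq_eq_legendre htT s]
        simp [Fin.sum_univ_succ]
        ring] with ω h
    rw [h]
    simp [Fin.sum_univ_succ]
    ring
  · filter_upwards [key 3 (by norm_num)
      ![-(√(T - t) ^ 7 / 4), -(√(T - t) ^ 7 / 4) * (3 * √3 / 5), -(√(T - t) ^ 7 / 4) * (1 / √5),
        -(√(T - t) ^ 7 / 4) * (1 / (5 * √7))]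
      fun s => by
        rw [sub_cube_eq_legendre htT s]
        simp [Fin.sum_univ_succ]
        ring] with ω h
    rw [h]
    simp [Fin.sum_univ_succ]
    ring
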